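/- Let $N>1$ be an integer. Let $S=\begin{pmatrix}0&-1\\1&0\end{pmatrix}$, $T=\begin{pmatrix}1&1\\0&1\end{pmatrix}$ in $SL_2(\mathbb Z)$, acting on the upper half plane $\mathbb H$ by Möbius transformations. For $j\in\mathbb Z$ let $W_j=\min\{m\in\mathbb Z_{>0} : mj-1\in(\mathbb Z/N)^*\}$ and $M_j=W_j-1$. Let $N_1=\lfloor (N-1)/2\rfloor$, $N_2=\lfloor N/2\rfloor$, $A=\{-N_1,\dots,N_2\}$, and $$\Theta=\{ST^i : i\in A\}\cup\{ST^jST^m : j\in A,\ \gcd(j,N)>1,\ 0\le m\le M_j\}.$$ Let $\overline D=\{z\in\mathbb H : |z|\ge 1,\ |\operatorname{Re}z|\le 1/2\}$, with edges $$L=\{z\in\mathbb H : \operatorname{Re}z=1/2,\ |z|\ge1\},\quad R=\{z\in\mathbb H : \operatorname{Re}z=-1/2,\ |z|\ge1\},\quad B=\{z\in\mathbb H : |z|=1,\ |\operatorname{Re}z|\le 1/2\},$$ and let $F=\bigcup_{\gamma\in\Theta}\gamma\overline D$ be the connected fundamental domain for $\Gamma_0(N)$ given by $\Theta$. Consider the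 following list of arcs: 1. $ST^{N_2}L$ and $ST^{-N_1}R$; 2. $ST^iB$ for each $i\in A$ with $\gcd(i,N)=1$; 3. for each $j\in A$ with $\gcd(j,N)>1$: (a) $ST^jSR$; (b) $ST^jST^{M_j}L$; (c) $ST^jST^mB$ for $1\le m\le M_j$. Then the topological boundary of $F$ in $\mathbb H$ is the union of the listed arcs. Moreover, the listed arcs are exactly the boundary arcs of $F$, i.e. exactly those sides $\gamma L$, $\gamma R$, $\gamma B$ $(\gamma\in\Theta)$ that are contained in the boundary of $F$. -/

import Mathlib

open scoped Pointwise MatrixGroups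

namespace LabelArcs

open ModularGroup

/-- `W_j`: the least positive integer `m` such that `m j - 1` is a unit modulo `N`
(for `N > 1` the integer `m = N` always qualifies). -/
noncomputable def W (N : ℕ) (j : ZMod N) : ℕ :=
  sInf {m : ℕ | 0 < m ∧ IsUnit ((m : ZMod N) * j - 1)}

/-- `M_j = W_j - 1`. -/
noncomputable def M (N : ℕ) (j : ZMod N) : ℕ := W N j - 1

/-- `N₁ = ⌊(N - 1) / 2⌋`. -/
def N₁ (N : ℕ) : ℤ := ((N : ℤ) - 1) / 2

/-- `N₂ = ⌊N / 2⌋`. -/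
def N₂ (N : ℕ) : ℤ := (N : ℤ) / 2

/-- The symmetric set `{-N₁, …, N₂}` of consecutive residue class representatives modulo `N`. -/
def A (N : ℕ) : Set ℤ := Set.Icc (-N₁ N) (N₂ N)

/-- The set of coset representatives
`{S T^i | i ∈ A} ∪ {S T^j S T^m | j ∈ A, gcd(j, N) > 1, 0 ≤ m ≤ M_j}`. -/
def Θ (N : ℕ) : Set SL(2, ℤ) :=
  {γ | ∃ i ∈ A N, γ = S * T ^ i} ∪
  {γ | ∃ j ∈ A N, 1 < Int.gcd j N ∧ ∃ m : ℕ, m ≤ M N (j : ZMod N) ∧ γ = S * T ^ j * S * T ^ m}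

/-- The left edge of the triangle (as seen from the cusp `∞`). -/
def L : Set UpperHalfPlane := {z | z.re = 1 / 2 ∧ 1 ≤ ‖(z : ℂ)‖}

/-- The right edge of the triangle (as seen from the cusp `∞`). -/
def R : Set UpperHalfPlane := {z | z.re = -(1 / 2) ∧ 1 ≤ ‖(z : ℂ)‖}

/-- The base of the triangle. -/
def B : Set UpperHalfPlane := {z | ‖(z : ℂ)‖ = 1 ∧ |z.re| ≤ 1 / 2}

/-- The fundamental domain given by `Θ`: the union of the translates `γ • fd`, `γ ∈ Θ`, where
`fd = {z ∈ ℍ | |z| ≥ 1, |Re z| ≤ 1/2}` is the standard closed ideal triangle. -/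
def domain (N : ℕ) : Set UpperHalfPlane := ⋃ γ ∈ Θ N, γ • fd

/-- The sides of the triangles which make up the domain. -/
def sides (N : ℕ) : Set (Set UpperHalfPlane) :=
  {C | ∃ γ ∈ Θ N, C = γ • L ∨ C = γ • R ∨ C = γ • B}

/-- The boundary arcs: the sides of the triangles of the domain that lie on its topological
boundary in the upper half plane. -/
def boundaryArcs (N : ℕ) : Set (Set UpperHalfPlane) :=
  {C | C ∈ sides N ∧ C ⊆ frontier (domain N)}

/-- The explicit list of arcs. -/
def listedArcs (N : ℕ) : Set (Set UpperHalfPlane) :=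
  {(S * T ^ N₂ N) • L, (S * T ^ (-N₁ N)) • R} ∪
  {C | ∃ i ∈ A N, Int.gcd i N = 1 ∧ C = (S * T ^ i) • B} ∪
  {C | ∃ j ∈ A N, 1 < Int.gcd j N ∧
    (C = (S * T ^ j * S) • R ∨
     C = (S * T ^ j * S * T ^ M N (j : ZMod N)) • L ∨
     ∃ m : ℕ, 1 ≤ m ∧ m ≤ M N (j : ZMod N) ∧ C = (S * T ^ j * S * T ^ m) • B)}

end LabelArcs

namespace LabelArcs

open ModularGroup UpperHalfPlane Topology

/-! For a finite set `X` of matrices modulo sign, a point is interior to `region X` exactly when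
every triangle through it belongs to `X`: local finiteness gives one direction, density of the open
triangle in the closed one the other. Triangles through a point are linked by crossing sides through
it, so the frontier is the union of the sides whose opposite triangle is missing
(`frontier_region`). A test point on each side shows that no other side lies in the frontier
(`mem_outerSides_iff`).

Crossing `L`, `R`, `B` multiplies on the right by `T`, `T⁻¹`, `S`. It remains to decide, from matrix
entries, which neighbours of elements of `Θ N` stay in `Θ N` up to sign; `M` enters only as the last
index of a row. -/

/-- The union of the translates of the closed standard triangle by the elements of `X`. -/
def region (X : Set SL(2, ℤ)) : Set ℍ := ⋃ γ ∈ X, γ • fd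

/-- The elements of `SL(2, ℤ)` which agree up to sign with an element of `X`. -/
def signClosure (X : Set SL(2, ℤ)) : Set SL(2, ℤ) := {γ | γ ∈ X ∨ -γ ∈ X}

lemma subset_signClosure (X : Set SL(2, ℤ)) : X ⊆ signClosure X := fun _ h ↦ Or.inl h

lemma neg_mem_signClosure {X : Set SL(2, ℤ)} {γ : SL(2, ℤ)} :
    -γ ∈ signClosure X ↔ γ ∈ signClosure X := by
  simp [signClosure, or_comm]

lemma mem_smul_iff {γ : SL(2, ℤ)} {s : Set ℍ} {z : ℍ} : z ∈ γ • s ↔ γ⁻¹ • z ∈ s :=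
  Set.mem_smul_set_iff_inv_smul_mem

lemma inv_neg_smul (γ : SL(2, ℤ)) (z : ℍ) : (-γ)⁻¹ • z = γ⁻¹ • z := by
  rw [inv_smul_eq_iff, SL_neg_smul, smul_inv_smul]

lemma mem_neg_smul_iff {γ : SL(2, ℤ)} {s : Set ℍ} {z : ℍ} : z ∈ (-γ) • s ↔ z ∈ γ • s := by
  rw [mem_smul_iff, mem_smul_iff, inv_neg_smul]

lemma mem_region_of_mem_signClosure {X : Set SL(2, ℤ)} {γ : SL(2, ℤ)} (hγ : γ ∈ signClosure X)
    {z : ℍ} (hz : z ∈ γ • fd) : z ∈ region X := by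
  rcases hγ with h | h
  · exact Set.mem_biUnion h hz
  · exact Set.mem_biUnion h (mem_neg_smul_iff.mpr hz)

/-! ### Local finiteness and interior points -/

instance : ContinuousConstSMul SL(2, ℤ) ℍ where
  continuous_const_smul γ := by
    simp only [sl_moeb]
    exact continuous_const_smul _

/-- With bottom row `(c, d)`: if `c = 0` then `d = ±1` and the height is unchanged; otherwise `|cz +
d|² ≥ (Im z)²`. -/
lemma im_smul_le_max (γ : SL(2, ℤ)) (z : ℍ) : (γ • z).im ≤ max z.im (1 / z.im) := by
  have hz := z.im_pos
  rw [ModularGroup.im_smul_eq_div_normSq]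
  by_cases hc : γ 1 0 = 0
  · have hd : γ 1 1 = 1 ∨ γ 1 1 = -1 := by
      simpa [hc, isCoprime_zero_left, Int.isUnit_iff] using bottom_row_coprime γ
    rcases hd with hd | hd <;> simp [denom_apply, hc, hd]
  · refine le_trans ?_ (le_max_right _ _)
    have h := z.c_mul_im_sq_le_normSq_denom (γ : GL (Fin 2) ℝ)
    have h1 : (1 : ℝ) ≤ (γ 1 0 : ℝ) ^ 2 := by
      exact_mod_cast (one_le_sq_iff_one_le_abs _).mpr (Int.one_le_abs hc)
    have h2 : z.im ^ 2 ≤ Complex.normSq (denom γ z) := by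
      refine le_trans ?_ h
      rw [mul_pow]
      exact le_mul_of_one_le_left (by positivity) (by simpa using h1)
    rw [div_le_div_iff₀ (lt_of_lt_of_le (by positivity) h2) hz]
    nlinarith

/-- The tessellation by translates of the standard triangle is locally finite. -/
lemma exists_nhds_finite (z : ℍ) :
    ∃ U ∈ 𝓝 z, {γ : SL(2, ℤ) | (U ∩ γ • fd).Nonempty}.Finite := by
  obtain ⟨K, hK, hz⟩ := exists_compact_mem_nhds z
  refine ⟨K, hz, ?_⟩
  obtain ⟨y, hy⟩ := hK.bddAbove_image (f := fun w : ℍ ↦ max w.im (1 / w.im))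
    (Continuous.continuousOn (continuous_im.max
      (continuous_const.div continuous_im fun w ↦ w.im_ne_zero)))
  -- Translates of points of `K` have height at most `y`, so those in `fd` lie in a compact
  -- truncation of it.
  have hfin := ProperlyDiscontinuousSMul.finite_disjoint_inter_image (Γ := 𝒮ℒ) hK
    (isCompact_truncatedFundamentalDomain y)
  let f : SL(2, ℤ) → 𝒮ℒ := fun γ ↦ ⟨Matrix.SpecialLinearGroup.mapGL ℝ γ⁻¹, γ⁻¹, rfl⟩
  have hf : Function.Injective f := fun γ γ' h ↦ by
    have := Matrix.SpecialLinearGroup.mapGL_injective (Subtype.ext_iff.mp h)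
    exact inv_injective this
  refine (hfin.preimage hf.injOn).subset ?_
  rintro γ ⟨w, hwK, hw⟩
  rw [mem_smul_iff] at hw
  exact ⟨γ⁻¹ • w, ⟨w, hwK, rfl⟩, hw,
    (im_smul_le_max _ _).trans (hy ⟨w, hwK, rfl⟩)⟩

lemma isClosed_region {X : Set SL(2, ℤ)} (hX : X.Finite) : IsClosed (region X) :=
  hX.isClosed_biUnion fun γ _ ↦ isClosed_fd.smul γ

/-- Near `z` there are points of the open triangle of `γ`, and these lie in no triangle other than
that of `±γ`. -/
lemma mem_signClosure_of_mem_interior {X : Set SL(2, ℤ)} {z : ℍ} (hz : z ∈ interior (region X))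
    {γ : SL(2, ℤ)} (hγ : z ∈ γ • fd) : γ ∈ signClosure X := by
  rw [fd_eq_closure_fdo, mem_smul_iff] at hγ
  have hopen : IsOpen ((fun w : ℍ ↦ γ • w) ⁻¹' interior (region X)) :=
    isOpen_interior.preimage (continuous_const_smul γ)
  obtain ⟨w, hw, hwo⟩ := mem_closure_iff.mp hγ _ hopen (by simpa using hz)
  obtain ⟨γ', hγ', hw'⟩ := Set.mem_iUnion₂.mp (interior_subset hw)
  rw [mem_smul_iff, ← mul_smul] at hw'
  rcases eq_one_or_neg_one_of_mem_fdo_mem_fd hwo hw' with h | h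
  · rw [inv_mul_eq_one] at h
    exact Or.inl (h ▸ hγ')
  · rw [inv_mul_eq_iff_eq_mul] at h
    exact Or.inr (by simpa [h] using hγ')

/-- A point is interior to a union of triangles once all triangles through it occur. -/
lemma mem_interior_of_forall {X : Set SL(2, ℤ)} {z : ℍ}
    (h : ∀ γ : SL(2, ℤ), z ∈ γ • fd → γ ∈ signClosure X) : z ∈ interior (region X) := by
  obtain ⟨U, hU, hfin⟩ := exists_nhds_finite z
  rw [mem_interior_iff_mem_nhds]
  -- Only finitely many triangles meet `U` but miss `z`; removing them leaves a neighbourhood of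
  -- `z`.
  have hV : (⋂ γ ∈ {γ : SL(2, ℤ) | (U ∩ γ • fd).Nonempty ∧ z ∉ γ • fd}, (γ • fd)ᶜ) ∈ 𝓝 z := by
    refine (Filter.biInter_mem (hfin.subset fun γ hγ ↦ hγ.1)).mpr fun γ hγ ↦ ?_
    exact (isClosed_fd.smul γ).isOpen_compl.mem_nhds hγ.2
  filter_upwards [hU, hV] with w hwU hwV
  obtain ⟨g, hg⟩ := exists_smul_mem_fd w
  have hwg : w ∈ g⁻¹ • fd := by rwa [mem_smul_iff, inv_inv]
  refine mem_region_of_mem_signClosure (h g⁻¹ ?_) hwg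
  by_contra hz
  exact Set.mem_iInter₂.mp hwV g⁻¹ ⟨⟨w, hwU, hwg⟩, hz⟩ hwg

/-! ### Sides and vertices of the standard triangle -/

lemma norm_sq_eq (z : ℍ) : ‖(z : ℂ)‖ ^ 2 = z.re ^ 2 + z.im ^ 2 := by
  rw [← Complex.normSq_eq_norm_sq, Complex.normSq_apply, coe_re, coe_im]
  ring

lemma one_le_norm_iff {z : ℍ} : 1 ≤ ‖(z : ℂ)‖ ↔ 1 ≤ z.re ^ 2 + z.im ^ 2 := by
  rw [← norm_sq_eq, one_le_sq_iff₀ (norm_nonneg _)]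

lemma norm_eq_one_iff {z : ℍ} : ‖(z : ℂ)‖ = 1 ↔ z.re ^ 2 + z.im ^ 2 = 1 := by
  rw [← norm_sq_eq, pow_eq_one_iff_of_nonneg (norm_nonneg _) two_ne_zero]

lemma mem_fd_iff {z : ℍ} : z ∈ fd ↔ 1 ≤ ‖(z : ℂ)‖ ∧ |z.re| ≤ 1 / 2 := by
  rw [one_le_norm_iff, ← norm_sq_eq, ← Complex.normSq_eq_norm_sq]
  rfl

lemma L_subset_fd : L ⊆ fd := fun z hz ↦ mem_fd_iff.mpr ⟨hz.2, by rw [hz.1]; norm_num⟩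

lemma R_subset_fd : R ⊆ fd := fun z hz ↦ mem_fd_iff.mpr ⟨hz.2, by rw [hz.1]; norm_num⟩

lemma B_subset_fd : B ⊆ fd := fun _ hz ↦ mem_fd_iff.mpr ⟨hz.1.ge, hz.2⟩

lemma T_smul_mem_L_iff {z : ℍ} : T • z ∈ L ↔ z ∈ R := by
  change (T • z).re = 1 / 2 ∧ 1 ≤ ‖((T • z : ℍ) : ℂ)‖ ↔ z.re = -(1 / 2) ∧ 1 ≤ ‖(z : ℂ)‖
  rw [one_le_norm_iff, one_le_norm_iff, re_T_smul, im_T_smul]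
  constructor <;> rintro ⟨h1, h2⟩ <;> refine ⟨by linarith, ?_⟩
  · rw [h1] at h2
    rw [show z.re = -(1 / 2) by linarith]
    linarith
  · rw [h1] at h2 ⊢
    linarith

lemma re_S_smul {z : ℍ} (hz : ‖(z : ℂ)‖ = 1) : (S • z).re = -z.re := by
  rw [modular_S_smul, ← coe_re, coe_mk, Complex.inv_re, Complex.normSq_neg,
    Complex.normSq_eq_norm_sq, hz]
  simp

lemma norm_S_smul (z : ℍ) : ‖((S • z : ℍ) : ℂ)‖ = ‖(z : ℂ)‖⁻¹ := by
  rw [modular_S_smul, coe_mk, norm_inv, norm_neg]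

lemma S_smul_mem_B {z : ℍ} (hz : z ∈ B) : S • z ∈ B :=
  ⟨by rw [norm_S_smul, hz.1, inv_one], by rw [re_S_smul hz.1, abs_neg]; exact hz.2⟩

lemma S_inv_smul (z : ℍ) : S⁻¹ • z = S • z := by
  rw [S_inv, SL_neg_smul]

lemma ρ_mem_R : ρ ∈ R := ⟨by norm_num [ρ], (norm_ρ).ge⟩

lemma ρ_mem_B : ρ ∈ B := ⟨norm_ρ, by norm_num [ρ]⟩

lemma T_smul_ρ_mem_L : T • ρ ∈ L := T_smul_mem_L_iff.mpr ρ_mem_R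

lemma S_smul_ρ : S • ρ = T • ρ := by
  rw [modular_T_smul, modular_S_smul, UpperHalfPlane.ext_iff]
  norm_num [ρ, Complex.ext_iff, Complex.normSq, ← pow_two, div_pow]

lemma T_smul_ρ_mem_B : T • ρ ∈ B := S_smul_ρ ▸ S_smul_mem_B ρ_mem_B

lemma S_smul_T_smul_ρ : S • T • ρ = ρ := by
  rw [← S_smul_ρ, ← S_inv_smul, inv_smul_smul]

/-! ### Chains of triangles around a point -/

lemma mem_of_inv_mul_eq {P : Set SL(2, ℤ)} (hneg : ∀ γ, -γ ∈ P ↔ γ ∈ P) {γ₀ γ h : SL(2, ℤ)}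
    (hh : γ₀ * h⁻¹ ∈ P) (hg : γ⁻¹ * γ₀ = h ∨ γ⁻¹ * γ₀ = -h) : γ ∈ P := by
  rcases hg with hg | hg <;> rw [inv_mul_eq_iff_eq_mul] at hg
  · rwa [hg, mul_inv_cancel_right] at hh
  · rwa [hg, mul_neg, neg_mul, mul_inv_cancel_right, hneg] at hh

/-- Any two triangles through a point are joined by a chain of triangles through that point
in which neighbours share a side containing the point. -/
lemma mem_of_adjacent_mem {P : Set SL(2, ℤ)} (hneg : ∀ γ, -γ ∈ P ↔ γ ∈ P) {z : ℍ}
    (hL : ∀ γ ∈ P, γ⁻¹ • z ∈ L → γ * T ∈ P) (hR : ∀ γ ∈ P, γ⁻¹ • z ∈ R → γ * T⁻¹ ∈ P)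
    (hB : ∀ γ ∈ P, γ⁻¹ • z ∈ B → γ * S ∈ P) {γ₀ γ : SL(2, ℤ)} (h₀ : γ₀ ∈ P)
    (hz₀ : γ₀⁻¹ • z ∈ fd) (hz : γ⁻¹ • z ∈ fd) : γ ∈ P := by
  have key (h : SL(2, ℤ)) := mem_of_inv_mul_eq hneg (γ₀ := γ₀) (γ := γ) (h := h)
  have hB' : ∀ γ ∈ P, γ⁻¹ • z ∈ B → γ * S⁻¹ ∈ P := fun γ hγ hw ↦ by
    rw [S_inv, mul_neg, hneg]
    exact hB γ hγ hw
  have hg : (γ⁻¹ * γ₀) • γ₀⁻¹ • z ∈ fd := by rwa [mul_smul, smul_inv_smul]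
  have hv : (1 : ℝ) +ᵥ ρ = T • ρ := (modular_T_smul ρ).symm
  rcases cases_of_mem_fd_smul_mem_fd hz₀ hg with
    h | ⟨h, hw⟩ | ⟨h, hw⟩ | ⟨h, hw⟩ | ⟨h, hw⟩ | ⟨h, hw⟩ | ⟨h, hw⟩ | ⟨h, hw⟩ | ⟨h, hw⟩ | ⟨h, hw⟩
  · exact key 1 (by simpa using h₀) h
  · exact key T (hR _ h₀ ⟨by rw [hw]; ring, (mem_fd_iff.mp hz₀).1⟩) h
  · exact key T⁻¹ (by rw [inv_inv]; exact hL _ h₀ ⟨hw, (mem_fd_iff.mp hz₀).1⟩) h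
  · exact key S (hB' _ h₀ ⟨hw, (mem_fd_iff.mp hz₀).2⟩) h
  -- In the remaining cases `γ₀⁻¹ • z` is a vertex, and each letter of `h⁻¹` is one crossing of a
  -- side through it.
  all_goals
    try rw [hv] at hw
    refine key _ ?_ h
    simp only [mul_inv_rev, inv_inv, ← mul_assoc]
  · refine hR _ (hB' _ h₀ ?_) ?_ <;>
    simp only [mul_inv_rev, mul_smul, hw, inv_inv, S_smul_T_smul_ρ, ρ_mem_R, T_smul_ρ_mem_B]
  · refine hL _ (hB' _ (hL _ h₀ ?_) ?_) ?_ <;>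
    simp only [mul_inv_rev, mul_smul, hw, inv_inv, S_smul_ρ, inv_smul_smul, ρ_mem_B, T_smul_ρ_mem_L]
  · refine hB' _ (hL _ h₀ ?_) ?_ <;>
    simp only [mul_inv_rev, mul_smul, hw, inv_smul_smul, ρ_mem_B, T_smul_ρ_mem_L]
  · refine hB' _ (hR _ h₀ ?_) ?_ <;>
    simp only [mul_inv_rev, mul_smul, hw, inv_inv, ρ_mem_R, T_smul_ρ_mem_B]
  · refine hR _ (hB' _ (hR _ h₀ ?_) ?_) ?_ <;>
    simp only [mul_inv_rev, mul_smul, hw, inv_inv, S_smul_T_smul_ρ, ρ_mem_R, T_smul_ρ_mem_B]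
  · refine hL _ (hB' _ h₀ ?_) ?_ <;>
    simp only [mul_inv_rev, mul_smul, hw, inv_inv, S_smul_ρ, ρ_mem_B, T_smul_ρ_mem_L]

/-! ### The frontier of a finite union of triangles -/

lemma mem_mul_T_smul_fd {γ : SL(2, ℤ)} {z : ℍ} (hz : z ∈ γ • L) : z ∈ (γ * T) • fd := by
  rw [mem_smul_iff] at hz ⊢
  refine R_subset_fd (T_smul_mem_L_iff.mp ?_)
  rwa [mul_inv_rev, mul_smul, smul_inv_smul]

lemma mem_mul_T_inv_smul_fd {γ : SL(2, ℤ)} {z : ℍ} (hz : z ∈ γ • R) :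
    z ∈ (γ * T⁻¹) • fd := by
  rw [mem_smul_iff] at hz ⊢
  rw [mul_inv_rev, inv_inv, mul_smul]
  exact L_subset_fd (T_smul_mem_L_iff.mpr hz)

lemma mem_mul_S_smul_fd {γ : SL(2, ℤ)} {z : ℍ} (hz : z ∈ γ • B) : z ∈ (γ * S) • fd := by
  rw [mem_smul_iff] at hz ⊢
  rw [mul_inv_rev, mul_smul, S_inv_smul]
  exact B_subset_fd (S_smul_mem_B hz)

/-- A side of a triangle of `X` such that the triangle on its other side is not in `X`. -/
def outerSides (X : Set SL(2, ℤ)) : Set (Set ℍ) :=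
  {C | ∃ γ ∈ X, (C = γ • L ∧ γ * T ∉ signClosure X) ∨ (C = γ • R ∧ γ * T⁻¹ ∉ signClosure X) ∨
    (C = γ • B ∧ γ * S ∉ signClosure X)}

lemma mem_frontier_of_notMem {X : Set SL(2, ℤ)} (hX : X.Finite) {γ γ' : SL(2, ℤ)} (hγ : γ ∈ X)
    (hγ' : γ' ∉ signClosure X) {z : ℍ} (hz : z ∈ γ • fd) (hz' : z ∈ γ' • fd) :
    z ∈ frontier (region X) := by
  rw [(isClosed_region hX).frontier_eq]
  exact ⟨Set.mem_biUnion hγ hz, fun h ↦ hγ' (mem_signClosure_of_mem_interior h hz')⟩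

lemma subset_frontier_of_mem_outerSides {X : Set SL(2, ℤ)} (hX : X.Finite) {C : Set ℍ}
    (hC : C ∈ outerSides X) : C ⊆ frontier (region X) := by
  obtain ⟨γ, hγ, ⟨rfl, h⟩ | ⟨rfl, h⟩ | ⟨rfl, h⟩⟩ := hC <;> intro z hz
  · exact mem_frontier_of_notMem hX hγ h (Set.smul_set_mono L_subset_fd hz) (mem_mul_T_smul_fd hz)
  · exact mem_frontier_of_notMem hX hγ h (Set.smul_set_mono R_subset_fd hz)
      (mem_mul_T_inv_smul_fd hz)
  · exact mem_frontier_of_notMem hX hγ h (Set.smul_set_mono B_subset_fd hz) (mem_mul_S_smul_fd hz)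

lemma frontier_region {X : Set SL(2, ℤ)} (hX : X.Finite) :
    frontier (region X) = ⋃₀ outerSides X := by
  refine subset_antisymm (fun z hz ↦ ?_)
    (Set.sUnion_subset fun C hC ↦ subset_frontier_of_mem_outerSides hX hC)
  rw [(isClosed_region hX).frontier_eq] at hz
  obtain ⟨hz, hzi⟩ := hz
  by_contra hC
  refine hzi (mem_interior_of_forall fun γ hγ ↦ ?_)
  obtain ⟨γ₀, hγ₀, hz₀⟩ := Set.mem_iUnion₂.mp hz
  -- It suffices to cross sides of triangles of `X` itself, up to sign.
  have cross {s : Set ℍ} {g : SL(2, ℤ)}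
      (h : ∀ γ ∈ X, γ⁻¹ • z ∈ s → γ * g ∈ signClosure X) :
      ∀ γ ∈ signClosure X, γ⁻¹ • z ∈ s → γ * g ∈ signClosure X := by
    rintro γ (hγ | hγ) hs
    · exact h γ hγ hs
    · rw [← neg_mem_signClosure, ← neg_mul]
      exact h _ hγ (by rwa [inv_neg_smul])
  refine mem_of_adjacent_mem (fun _ ↦ neg_mem_signClosure) (cross ?_) (cross ?_) (cross ?_)
    (subset_signClosure X hγ₀) (mem_smul_iff.mp hz₀) (mem_smul_iff.mp hγ)
  all_goals
    intro γ hγ hs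
    by_contra h
  · exact hC ⟨_, ⟨γ, hγ, Or.inl ⟨rfl, h⟩⟩, mem_smul_iff.mpr hs⟩
  · exact hC ⟨_, ⟨γ, hγ, Or.inr (Or.inl ⟨rfl, h⟩)⟩, mem_smul_iff.mpr hs⟩
  · exact hC ⟨_, ⟨γ, hγ, Or.inr (Or.inr ⟨rfl, h⟩)⟩, mem_smul_iff.mpr hs⟩

/-- A point of the side `L` which lies on no other side. -/
noncomputable def pointL : ℍ := ⟨1 / 2 + 2 * Complex.I, by simp⟩

lemma pointL_re : pointL.re = 1 / 2 := by simp [pointL, ← coe_re]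

lemma pointL_im : pointL.im = 2 := by simp [pointL, ← coe_im]

lemma pointL_mem_L : pointL ∈ L :=
  ⟨pointL_re, by rw [one_le_norm_iff, pointL_re, pointL_im]; norm_num⟩

lemma I_mem_B : I ∈ B := ⟨by simp, by simp⟩

/-- Only the triangles of `±γ` and `±γ * T` contain this point, so a side with both neighbours
present is not in the frontier. -/
lemma smul_pointL_mem_interior {X : Set SL(2, ℤ)} {γ : SL(2, ℤ)} (hγ : γ ∈ signClosure X)
    (hT : γ * T ∈ signClosure X) : γ • pointL ∈ interior (region X) := by
  refine mem_interior_of_forall fun γ' hγ' ↦ ?_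
  have hnorm : ‖(pointL : ℂ)‖ ≠ 1 := fun h ↦ by
    rw [norm_eq_one_iff, pointL_re, pointL_im] at h
    norm_num at h
  have hρ : pointL ≠ ρ := fun h ↦ hnorm (h ▸ norm_ρ)
  have hρ' : pointL ≠ (1 : ℝ) +ᵥ ρ := fun h ↦
    hnorm (h ▸ modular_T_smul ρ ▸ T_smul_ρ_mem_B.1)
  have hre : pointL.re ≠ -1 / 2 := by rw [pointL_re]; norm_num
  have hg : (γ'⁻¹ * γ) • pointL ∈ fd := by rwa [mul_smul, ← mem_smul_iff]
  have key (h : SL(2, ℤ)) :=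
    mem_of_inv_mul_eq (fun _ ↦ neg_mem_signClosure (X := X)) (γ₀ := γ) (γ := γ') (h := h)
  have := cases_of_mem_fd_smul_mem_fd (L_subset_fd pointL_mem_L) hg
  simp only [hnorm, hρ, hρ', hre, and_false, false_or, or_false] at this
  rcases this with h | ⟨h, -⟩
  · exact key 1 (by simpa using hγ) h
  · exact key T⁻¹ (by simpa using hT) h

lemma smul_I_mem_interior {X : Set SL(2, ℤ)} {γ : SL(2, ℤ)} (hγ : γ ∈ signClosure X)
    (hS : γ * S ∈ signClosure X) : γ • I ∈ interior (region X) := by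
  refine mem_interior_of_forall fun γ' hγ' ↦ ?_
  have hρ : I ≠ ρ := fun h ↦ by
    have := ρ_mem_R.1
    rw [← h, I_re] at this
    norm_num at this
  have hρ' : I ≠ (1 : ℝ) +ᵥ ρ := fun h ↦ by
    have := T_smul_ρ_mem_L.1
    rw [modular_T_smul, ← h, I_re] at this
    norm_num at this
  have hre : I.re ≠ -1 / 2 := by rw [I_re]; norm_num
  have hre' : I.re ≠ 1 / 2 := by rw [I_re]; norm_num
  have hg : (γ'⁻¹ * γ) • I ∈ fd := by rwa [mul_smul, ← mem_smul_iff]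
  have key (h : SL(2, ℤ)) :=
    mem_of_inv_mul_eq (fun _ ↦ neg_mem_signClosure (X := X)) (γ₀ := γ) (γ := γ') (h := h)
  have := cases_of_mem_fd_smul_mem_fd I_mem_fd hg
  simp only [hρ, hρ', hre, hre', and_false, false_or, or_false] at this
  rcases this with h | ⟨h, -⟩
  · exact key 1 (by simpa using hγ) h
  · exact key S (by rwa [S_inv, mul_neg, neg_mem_signClosure]) h

/-- The sides contained in the frontier are those whose opposite triangle is missing. -/
lemma mem_outerSides_iff {X : Set SL(2, ℤ)} (hX : X.Finite) {C : Set ℍ} :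
    C ∈ outerSides X ↔
      (∃ γ ∈ X, C = γ • L ∨ C = γ • R ∨ C = γ • B) ∧ C ⊆ frontier (region X) := by
  refine ⟨fun hC ↦ ⟨?_, subset_frontier_of_mem_outerSides hX hC⟩, ?_⟩
  · obtain ⟨γ, hγ, h⟩ := hC
    exact ⟨γ, hγ, h.imp And.left (Or.imp And.left And.left)⟩
  rintro ⟨⟨γ, hγ, h⟩, hC⟩
  have hγ' := subset_signClosure X hγ
  rw [(isClosed_region hX).frontier_eq] at hC
  refine ⟨γ, hγ, ?_⟩
  rcases h with rfl | rfl | rfl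
  · exact Or.inl ⟨rfl, fun h ↦ (hC (Set.smul_mem_smul_set pointL_mem_L)).2
      (smul_pointL_mem_interior hγ' h)⟩
  -- `γ • R` is the side `L` of the triangle of `γ * T⁻¹`, so the same test point serves.
  · refine Or.inr (Or.inl ⟨rfl, fun h ↦ (hC ?_).2
      (smul_pointL_mem_interior h (by rwa [inv_mul_cancel_right]))⟩)
    rw [mul_smul]
    exact Set.smul_mem_smul_set (T_smul_mem_L_iff.mp (by rw [smul_inv_smul]; exact pointL_mem_L))
  · exact Or.inr (Or.inr ⟨rfl, fun h ↦ (hC (Set.smul_mem_smul_set I_mem_B)).2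
      (smul_I_mem_interior hγ' h)⟩)

/-! ### Neighbours of the triangles of `Θ` -/

lemma finite_Θ (N : ℕ) : (Θ N).Finite := by
  have hA : (A N).Finite := Set.finite_Icc _ _
  refine ((hA.image fun i ↦ S * T ^ i).subset ?_).union
    ((hA.biUnion (t := fun j ↦ (fun m : ℕ ↦ S * T ^ j * S * T ^ m) '' Set.Iic (M N (j : ZMod N)))
      fun j _ ↦ (Set.finite_Iic _).image _).subset ?_)
  · rintro γ ⟨i, hi, rfl⟩
    exact ⟨i, hi, rfl⟩
  · rintro γ ⟨j, hj, -, m, hm, rfl⟩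
    exact Set.mem_biUnion hj ⟨m, hm, rfl⟩

lemma coe_S_mul_T_zpow (i : ℤ) :
    ((S * T ^ i : SL(2, ℤ)) : Matrix (Fin 2) (Fin 2) ℤ) = !![0, -1; 1, i] := by
  simp [coe_S, coe_T_zpow]

lemma coe_S_mul_T_zpow_mul_S_mul_T_zpow (j m : ℤ) :
    ((S * T ^ j * S * T ^ m : SL(2, ℤ)) : Matrix (Fin 2) (Fin 2) ℤ) =
      !![-1, -m; j, j * m - 1] := by
  simp [coe_S, coe_T_zpow]
  ring

lemma S_mul_T_zpow_mem_Θ {N : ℕ} {i : ℤ} (hi : i ∈ A N) : S * T ^ i ∈ Θ N :=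
  Or.inl ⟨i, hi, rfl⟩

lemma S_mul_T_zpow_mul_S_mul_T_zpow_mem_Θ {N : ℕ} {j m : ℤ} (hj : j ∈ A N)
    (hg : 1 < Int.gcd j N) (h0 : 0 ≤ m) (hm : m ≤ M N (j : ZMod N)) :
    S * T ^ j * S * T ^ m ∈ Θ N := by
  lift m to ℕ using h0
  exact Or.inr ⟨j, hj, hg, m, by exact_mod_cast hm, by rw [zpow_natCast]⟩

/-- Products of two entries ignore the sign and recover the parameters `i`, `j` and `m`. -/
lemma mem_signClosure_Θ {N : ℕ} {γ : SL(2, ℤ)} (h : γ ∈ signClosure (Θ N)) :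
    (γ 0 0 = 0 ∧ -(γ 0 1 * γ 1 1) ∈ A N) ∨
      ((γ 0 0) ^ 2 = 1 ∧ 0 ≤ γ 0 0 * γ 0 1 ∧ 1 < Int.gcd (γ 1 0) N ∧
        γ 0 0 * γ 0 1 ≤ M N ((-(γ 0 0 * γ 1 0) : ℤ) : ZMod N)) := by
  rcases h with (⟨i, hi, h⟩ | ⟨j, hj, hg, m, hm, h⟩) | (⟨i, hi, h⟩ | ⟨j, hj, hg, m, hm, h⟩)
  all_goals
    have hv := congrArg (fun g : SL(2, ℤ) ↦ (g : Matrix (Fin 2) (Fin 2) ℤ)) h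
    simp only [← zpow_natCast, coe_S_mul_T_zpow, coe_S_mul_T_zpow_mul_S_mul_T_zpow,
      Matrix.SpecialLinearGroup.coe_neg, neg_eq_iff_eq_neg] at hv
  · exact Or.inl (by simp [hv, hi])
  · exact Or.inr (by simp [hv, hg, hm])
  · exact Or.inl (by simp [hv, hi])
  · exact Or.inr (by simp [hv, hg, hm])

lemma neg_N₁_mem_A {N : ℕ} (hN : 1 < N) : -N₁ N ∈ A N := by
  simp only [A, N₁, N₂, Set.mem_Icc]
  omega

lemma N₂_mem_A {N : ℕ} (hN : 1 < N) : N₂ N ∈ A N := by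
  simp only [A, N₁, N₂, Set.mem_Icc]
  omega

lemma one_lt_gcd_iff {N : ℕ} (hN : 1 < N) (i : ℤ) : 1 < Int.gcd i N ↔ Int.gcd i N ≠ 1 := by
  have : 0 < Int.gcd i N := Int.gcd_pos_of_ne_zero_right _ (by omega)
  omega

lemma S_mul_T_zpow_mul_T (i : ℤ) : S * T ^ i * T = S * T ^ (i + 1) := by
  rw [mul_assoc, zpow_add_one]

lemma S_mul_T_zpow_mul_T_inv (i : ℤ) : S * T ^ i * T⁻¹ = S * T ^ (i - 1) := by
  rw [mul_assoc, zpow_sub_one]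

lemma S_mul_T_zpow_mul_S_mul_T_zpow_mul_T (j m : ℤ) :
    S * T ^ j * S * T ^ m * T = S * T ^ j * S * T ^ (m + 1) := by
  rw [mul_assoc _ (T ^ m), zpow_add_one]

lemma S_mul_T_zpow_mul_S_mul_T_zpow_mul_T_inv (j m : ℤ) :
    S * T ^ j * S * T ^ m * T⁻¹ = S * T ^ j * S * T ^ (m - 1) := by
  rw [mul_assoc _ (T ^ m), zpow_sub_one]

lemma S_mul_T_zpow_mem_signClosure_iff {N : ℕ} {i : ℤ} :
    S * T ^ i ∈ signClosure (Θ N) ↔ i ∈ A N := by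
  refine ⟨fun h ↦ ?_, fun h ↦ subset_signClosure _ (S_mul_T_zpow_mem_Θ h)⟩
  simpa [coe_S_mul_T_zpow, -Matrix.SpecialLinearGroup.coe_mul] using mem_signClosure_Θ h

lemma S_mul_T_zpow_mul_S_mul_T_zpow_mem_signClosure_iff {N : ℕ} {j m : ℤ} (hj : j ∈ A N) :
    S * T ^ j * S * T ^ m ∈ signClosure (Θ N) ↔
      1 < Int.gcd j N ∧ 0 ≤ m ∧ m ≤ M N (j : ZMod N) := by
  refine ⟨fun h ↦ ?_, fun ⟨hg, h0, hm⟩ ↦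
    subset_signClosure _ (S_mul_T_zpow_mul_S_mul_T_zpow_mem_Θ hj hg h0 hm)⟩
  have := mem_signClosure_Θ h
  simp [coe_S_mul_T_zpow_mul_S_mul_T_zpow, -Matrix.SpecialLinearGroup.coe_mul] at this
  tauto

lemma S_mul_T_zpow_mul_S_mem_signClosure_iff {N : ℕ} {j : ℤ} (hj : j ∈ A N) :
    S * T ^ j * S ∈ signClosure (Θ N) ↔ 1 < Int.gcd j N := by
  simpa using S_mul_T_zpow_mul_S_mul_T_zpow_mem_signClosure_iff (m := 0) hj

lemma S_mul_T_zpow_mul_S_mul_T_zpow_mul_S_notMem {N : ℕ} {j m : ℤ} (hm : 1 ≤ m) :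
    S * T ^ j * S * T ^ m * S ∉ signClosure (Θ N) := by
  intro h
  have hv : ((S * T ^ j * S * T ^ m * S : SL(2, ℤ)) : Matrix (Fin 2) (Fin 2) ℤ) =
      !![-m, 1; j * m - 1, -j] := by
    rw [Matrix.SpecialLinearGroup.coe_mul, coe_S_mul_T_zpow_mul_S_mul_T_zpow, coe_S]
    simp
  have := mem_signClosure_Θ h
  simp [hv, -Matrix.SpecialLinearGroup.coe_mul] at this
  omega

/-- Since `S² = -1`, the base for `m = 0` is shared with the triangle of `S * T ^ j`; hence the
listed bases start at `m = 1`. -/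
lemma S_mul_T_zpow_mul_S_mul_S_mem_signClosure {N : ℕ} {j : ℤ} (hj : j ∈ A N) :
    S * T ^ j * S * S ∈ signClosure (Θ N) := by
  have hS : S * S = -1 := by decide
  rw [mul_assoc _ S, hS, mul_neg_one, neg_mem_signClosure, S_mul_T_zpow_mem_signClosure_iff]
  exact hj

lemma listedArcs_subset_outerSides {N : ℕ} (hN : 1 < N) : listedArcs N ⊆ outerSides (Θ N) := by
  have h₁ := neg_N₁_mem_A hN
  have h₂ := N₂_mem_A hN
  rintro C (((rfl | rfl) | ⟨i, hi, hg, rfl⟩) | ⟨j, hj, hg, rfl | rfl | ⟨m, h1, hm, rfl⟩⟩)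
  · refine ⟨_, S_mul_T_zpow_mem_Θ h₂, Or.inl ⟨rfl, ?_⟩⟩
    rw [S_mul_T_zpow_mul_T, S_mul_T_zpow_mem_signClosure_iff]
    exact fun h ↦ by linarith [h.2]
  · refine ⟨_, S_mul_T_zpow_mem_Θ h₁, Or.inr (Or.inl ⟨rfl, ?_⟩)⟩
    rw [S_mul_T_zpow_mul_T_inv, S_mul_T_zpow_mem_signClosure_iff]
    exact fun h ↦ by linarith [h.1]
  · refine ⟨_, S_mul_T_zpow_mem_Θ hi, Or.inr (Or.inr ⟨rfl, ?_⟩)⟩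
    rw [S_mul_T_zpow_mul_S_mem_signClosure_iff hi]
    omega
  · refine ⟨_, S_mul_T_zpow_mul_S_mul_T_zpow_mem_Θ hj hg le_rfl (Nat.cast_nonneg _),
      Or.inr (Or.inl ⟨by rw [zpow_zero, mul_one], ?_⟩)⟩
    rw [S_mul_T_zpow_mul_S_mul_T_zpow_mul_T_inv,
      S_mul_T_zpow_mul_S_mul_T_zpow_mem_signClosure_iff hj]
    omega
  · refine ⟨_, S_mul_T_zpow_mul_S_mul_T_zpow_mem_Θ hj hg (Nat.cast_nonneg _) le_rfl,
      Or.inl ⟨by rw [zpow_natCast], ?_⟩⟩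
    rw [S_mul_T_zpow_mul_S_mul_T_zpow_mul_T,
      S_mul_T_zpow_mul_S_mul_T_zpow_mem_signClosure_iff hj]
    omega
  · exact ⟨_, S_mul_T_zpow_mul_S_mul_T_zpow_mem_Θ hj hg (Nat.cast_nonneg m) (by exact_mod_cast hm),
      Or.inr (Or.inr ⟨by rw [zpow_natCast],
        S_mul_T_zpow_mul_S_mul_T_zpow_mul_S_notMem (by exact_mod_cast h1)⟩)⟩

lemma outerSides_subset_listedArcs {N : ℕ} (hN : 1 < N) : outerSides (Θ N) ⊆ listedArcs N := by
  rintro C ⟨γ, ⟨i, hi, rfl⟩ | ⟨j, hj, hg, m, hm, rfl⟩, ⟨rfl, h⟩ | ⟨rfl, h⟩ | ⟨rfl, h⟩⟩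
  · rw [S_mul_T_zpow_mul_T, S_mul_T_zpow_mem_signClosure_iff, A, Set.mem_Icc] at h
    obtain rfl : i = N₂ N := by
      have := hi.1
      have := hi.2
      omega
    exact Or.inl (Or.inl (Or.inl rfl))
  · rw [S_mul_T_zpow_mul_T_inv, S_mul_T_zpow_mem_signClosure_iff, A, Set.mem_Icc] at h
    obtain rfl : i = -N₁ N := by
      have := hi.1
      have := hi.2
      omega
    exact Or.inl (Or.inl (Or.inr rfl))
  · rw [S_mul_T_zpow_mul_S_mem_signClosure_iff hi, one_lt_gcd_iff hN, not_not] at h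
    exact Or.inl (Or.inr ⟨i, hi, h, rfl⟩)
  · rw [← zpow_natCast, S_mul_T_zpow_mul_S_mul_T_zpow_mul_T,
      S_mul_T_zpow_mul_S_mul_T_zpow_mem_signClosure_iff hj] at h
    obtain rfl : m = M N (j : ZMod N) := by omega
    exact Or.inr ⟨j, hj, hg, Or.inr (Or.inl rfl)⟩
  · rw [← zpow_natCast, S_mul_T_zpow_mul_S_mul_T_zpow_mul_T_inv,
      S_mul_T_zpow_mul_S_mul_T_zpow_mem_signClosure_iff hj] at h
    obtain rfl : m = 0 := by omega
    exact Or.inr ⟨j, hj, hg, Or.inl (by rw [pow_zero, mul_one])⟩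
  · rcases Nat.eq_zero_or_pos m with rfl | h1
    · rw [pow_zero, mul_one] at h
      exact absurd (S_mul_T_zpow_mul_S_mul_S_mem_signClosure hj) h
    · exact Or.inr ⟨j, hj, hg, Or.inr (Or.inr ⟨m, h1, hm, rfl⟩)⟩

lemma listedArcs_eq_outerSides {N : ℕ} (hN : 1 < N) : listedArcs N = outerSides (Θ N) :=
  (listedArcs_subset_outerSides hN).antisymm (outerSides_subset_listedArcs hN)

end LabelArcs

theorem proposition1p4 (N : ℕ) (hN : 1 < N) :
    frontier (LabelArcs.domain N) = ⋃₀ LabelArcs.listedArcs N ∧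
      LabelArcs.boundaryArcs N = LabelArcs.listedArcs N := by
  rw [LabelArcs.listedArcs_eq_outerSides hN]
  exact ⟨LabelArcs.frontier_region (LabelArcs.finite_Θ N),
    Set.ext fun _ ↦ (LabelArcs.mem_outerSides_iff (LabelArcs.finite_Θ N)).symm⟩
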